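/- Let $\sigma_0^2>0$. For $v>0$ let $f_v(y)=\frac{1}{\pi v}e^{-|y|^2/v}$ be the density of the complex normal law $\mathcal{CN}(0,v)$, and let $I(v)=\mathbb E_{Y\sim\mathcal{CN}(0,v)}\big[\ln\frac{f_v(Y)}{f_{\sigma_0^2}(Y)}\big]$ be the Kullback--Leibler divergence of $\mathcal{CN}(0,v)$ from $\mathcal{CN}(0,\sigma_0^2)$. For $0<a<1$ and $\tau>0$ put $$L'=\sigma_0^2\Big(1-\ln\sigma_0^2-\frac{\ln a}{\tau}\Big),$$ and consider the condition $$(\ast)\qquad \sigma^2-\sigma_0^2\ln\sigma^2\le L'.$$ For $0<\sigma_{\min}^2<\sigma_0^2$, the GLR-CUSUM test with design parameter $a$ applied to received symbols $y_1,y_2,\dots$ has the statistic and the stopping time $$\Upsilon(t)=\max_{1\le k\le t}\ \sup_{v\in[\sigma_{\min}^2,\sigma_0^2]}\ \sum_{i=k+1}^{t}\ln\frac{f_v(y_i)}{f_{\sigma_0^2}(y_i)},\qquad T=\inf\{t\ge 1:\Upsilon(t)\ge\epsilon\}\quad(\inf\emptyset=\infty),$$ with threshold $\epsilon=-\ln(a/b)$,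 where $b=3\ln(a^{-1})\big(1+\tfrac1{I(\sigma_{\min}^2)}\big)^2$. Its average run length to detection $\mathrm{ARLD}(\sigma^2)$ is $\mathbb E[T]\in[0,\infty]$ when $y_1,y_2,\dots$ are i.i.d. with law $\mathcal{CN}(0,\sigma^2)$ (the attack is present from the beginning). 1. Let $0<a<1$ and $\tau>0$. For every $\sigma^2\in(0,\sigma_0^2)$ we have $I(\sigma^2)>0$, and Lorden's lower bound $\ln(a^{-1})/I(\sigma^2)$ on the average run length to detection is at least $\tau$ if and only if $(\ast)$ holds. Moreover, $(\ast)$ reduces to a threshold condition: there is $Q'\in(0,\sigma_0^2)$ such that for every $\sigma^2\in(0,\sigma_0^2]$, $(\ast)$ holds if and only if $\sigma^2\ge Q'$. 2. The condition $(\ast)$ ensures $\mathrm{ARLD}\ge\tau$ in the regime of small $a$: let $0<\sigma_{\min}^2<\sigma_0^2$ and $C>0$. There is $a_0\in(0,1)$ such that for all $0<a<a_0$, all $0<\tau\le C\ln(a^{-1})$ and all $\sigma^2\in[\sigma_{\min}^2,\sigma_0^2]$ that satisfy $(\ast)$, $$\mathrm{ARLD}(\sigma^2)\ge\tau .$$ 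-/

import Mathlib

open MeasureTheory ProbabilityTheory
open scoped ENNReal NNReal

namespace GLRAttack

noncomputable section

/-- The circularly symmetric complex normal law `CN(0, v)` of variance `v`: the real and the
imaginary part are independent real normal variables of mean `0` and variance `v / 2`. -/
def complexNormal (v : ℝ) : Measure ℂ :=
  ((gaussianReal 0 (v / 2).toNNReal).prod (gaussianReal 0 (v / 2).toNNReal)).map
    Complex.measurableEquivRealProd.symm

instance (v : ℝ) : IsProbabilityMeasure (complexNormal v) :=
  Measure.isProbabilityMeasure_map Complex.measurableEquivRealProd.symm.measurable.aemeasurable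

/-- The probability density function of `CN(0, v)`, for `v > 0`. -/
def complexNormalPDF (v : ℝ) (y : ℂ) : ℝ :=
  1 / (Real.pi * v) * Real.exp (-‖y‖ ^ 2 / v)

theorem complexNormal_eq_withDensity {v : ℝ} (hv : 0 < v) :
    complexNormal v = volume.withDensity fun y => ENNReal.ofReal (complexNormalPDF v y) := by
  have hv2 : (v / 2).toNNReal ≠ 0 := by
    simpa [Real.toNNReal_eq_zero] using hv
  have hpdf : Measurable fun y => ENNReal.ofReal (complexNormalPDF v y) := by
    unfold complexNormalPDF
    fun_prop
  have hvol := Complex.volume_preserving_equiv_real_prod.symm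
  rw [complexNormal, gaussianReal_of_var_ne_zero _ hv2,
    prod_withDensity (measurable_gaussianPDF _ _) (measurable_gaussianPDF _ _)]
  ext s hs
  rw [Measure.map_apply Complex.measurableEquivRealProd.symm.measurable hs,
    withDensity_apply _ (Complex.measurableEquivRealProd.symm.measurable hs),
    withDensity_apply _ hs, ← hvol.setLIntegral_comp_preimage hs hpdf]
  refine lintegral_congr fun p => ?_
  simp only [gaussianPDF]
  rw [← ENNReal.ofReal_mul (gaussianPDFReal_nonneg _ _ _)]
  congr 1
  simp only [gaussianPDFReal, complexNormalPDF, Complex.measurableEquivRealProd_symm_apply,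
    Real.coe_toNNReal _ (by positivity : (0 : ℝ) ≤ v / 2), Complex.sq_norm, Complex.normSq_mk,
    sub_zero]
  have h1 : 2 * Real.pi * (v / 2) = Real.pi * v := by ring
  have h2 : 2 * (v / 2) = v := by ring
  rw [h1, h2, mul_mul_mul_comm, ← Real.exp_add, ← mul_inv,
    Real.mul_self_sqrt (by positivity), one_div]
  congr 2
  ring

/-- The log-likelihood ratio `ln (f_{1,v}(y) / f_0(y))` of one received symbol `y`, where
`f_{1,v}` and `f_0` are the densities of `CN(0, v)` and `CN(0, v₀)`. -/
def logLikelihoodRatio (v₀ v : ℝ) (y : ℂ) : ℝ :=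
  Real.log (complexNormalPDF v y / complexNormalPDF v₀ y)

/-- The Kullback–Leibler divergence `I(v)` of `CN(0, v)` from `CN(0, v₀)`: the expectation under
`CN(0, v)` of the log-likelihood ratio. -/
def klInfo (v₀ v : ℝ) : ℝ :=
  ∫ y, logLikelihoodRatio v₀ v y ∂(complexNormal v)

/-- The GLR-CUSUM statistic
`Υ(t) = max_{1 ≤ k ≤ t} sup_{v ∈ [vmin, v₀]} ∑_{i = k+1}^{t} ln (f_{1,v}(y_i) / f_0(y_i))`
of the received symbols `y 1, y 2, …` (the value `y 0` is never used), for `t ≥ 1`. -/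
def glrStatistic (vmin v₀ : ℝ) (y : ℕ → ℂ) (t : ℕ) : ℝ :=
  ⨆ k : Set.Icc 1 t, ⨆ v : Set.Icc vmin v₀,
    ∑ i ∈ Finset.Ioc (k : ℕ) t, logLikelihoodRatio v₀ (v : ℝ) (y i)

/-- The GLR-CUSUM stopping time `T = inf {t ≥ 1 : Υ(t) ≥ ε}`, equal to `⊤` if no alarm is ever
raised. -/
def glrStoppingTime (vmin v₀ ε : ℝ) (y : ℕ → ℂ) : ℕ∞ :=
  sInf {n : ℕ∞ | ∃ t : ℕ, n = t ∧ 1 ≤ t ∧ ε ≤ glrStatistic vmin v₀ y t}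

/-- `b = 3 ln(a⁻¹) (1 + 1 / I(vmin))²`. -/
def glrB (vmin v₀ a : ℝ) : ℝ :=
  3 * Real.log a⁻¹ * (1 + 1 / klInfo v₀ vmin) ^ 2

/-- The threshold `ε = -ln (a / b)` of the test with design parameter `a`. -/
def glrThreshold (vmin v₀ a : ℝ) : ℝ :=
  -Real.log (a / glrB vmin v₀ a)

/-- The average run length to detection of the GLR-CUSUM test with design parameter `a`: the
expected stopping time when the attack is present from the beginning, so that the received symbols
are independent with law `CN(0, v)`. -/
def arld (vmin v₀ a v : ℝ) : ℝ≥0∞ :=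
  ∫⁻ y, (glrStoppingTime vmin v₀ (glrThreshold vmin v₀ a) y : ℝ≥0∞)
    ∂(Measure.infinitePi fun _ : ℕ => complexNormal v)

/-- The bound `L' = v₀ (1 - ln v₀ - (ln a) / τ)`. -/
def attackBound (v₀ a τ : ℝ) : ℝ :=
  v₀ * (1 - Real.log v₀ - Real.log a / τ)

end

end GLRAttack

namespace GLRAttack

/-! Write `A = ln(a⁻¹)`. The divergence is `ln(v₀/v) + v/v₀ - 1`, strictly decreasing on `(0, v₀]`
with value `0` at `v₀` and unbounded near `0`. Rearranged, (∗) says `I(v) ≤ A/τ`, which gives the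
first half.

For the second half, let `S_t` be the walk of the log-likelihood ratios of the true variance `v`;
its drift is `I(v)`. For `0 < θ < 1`, a change point `k` and an alternative `w`, compare the sum for
`w` after `k` with `S_t` through `exp(θ(sum - S_t))`. Its factors after `k` have mean a Hellinger
integral, at most `1`; those up to `k` have mean at most some `ρ < 1`. Divided by `ρ^k` it is thus a
nonnegative supermartingale. The mixture `Z_t` over all `k`, with weights about `ρ^k`, and over `m`
alternatives starts below `c = m/(1-ρ)`. Since `ln Z ≤ ln c + Z/c - 1`, the process `W_t = K + S_t +
(ln c + Z_t/c)/θ` dominates every such sum plus `K`, while its drift is at most `I(v)`. Optional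
stopping (`le_mul_sum_measureReal_of_drift_le`) bounds `E[T]` below by (level - `W_0`)/`I(v)`; this
is `exists_le_lintegral_detectionTime`.

The supremum over `w` is replaced by a grid in the precision `1/w`: up to the horizon `M²`, `M + 2`
points lose only a constant `K` (`exists_sum_logLikelihoodRatio_le`). The price in `W_0` is `(ln
M)/θ`, and `M` of order `√A` suffices. With `θ = 3/4` this is about `(2/3) ln A`, less than the `ln
A` by which `b` raises the threshold (`exists_grid_size`).

Near `v₀` no `ρ < 1` serves all `v`. There `S_t` is replaced by the deterministic walk of slope
`1/C`, and `τ ≤ C A` does the work of (∗). -/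

/-! ### Moments of the complex normal law and the divergence in closed form. -/

theorem complexNormalPDF_nonneg {v : ℝ} (hv : 0 < v) (y : ℂ) : 0 ≤ complexNormalPDF v y := by
  unfold complexNormalPDF
  positivity

theorem measurable_complexNormalPDF (v : ℝ) : Measurable (complexNormalPDF v) := by
  unfold complexNormalPDF
  fun_prop

theorem lintegral_complexNormalPDF {v : ℝ} (hv : 0 < v) :
    ∫⁻ y, ENNReal.ofReal (complexNormalPDF v y) = 1 := by
  have h := measure_univ (μ := complexNormal v)
  rwa [complexNormal_eq_withDensity hv, withDensity_apply _ MeasurableSet.univ,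
    Measure.restrict_univ] at h

theorem logLikelihoodRatio_eq {v₀ v : ℝ} (hv₀ : 0 < v₀) (hv : 0 < v) (y : ℂ) :
    logLikelihoodRatio v₀ v y = Real.log v₀ - Real.log v - (1 / v - 1 / v₀) * ‖y‖ ^ 2 := by
  unfold logLikelihoodRatio complexNormalPDF
  have hpi := Real.pi_pos
  rw [Real.log_div (by positivity) (by positivity), Real.log_mul (by positivity) (by positivity),
    Real.log_mul (by positivity) (by positivity), Real.log_exp, Real.log_exp, one_div, one_div,
    Real.log_inv, Real.log_inv, Real.log_mul (by positivity) (by positivity),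
    Real.log_mul (by positivity) (by positivity)]
  ring

/-- The Laplace transform of `‖y‖ ^ 2` under `CN(0, v)`. -/
theorem lintegral_exp_neg_mul_sq_norm {v s : ℝ} (hv : 0 < v) (hs : 0 < 1 + s * v) :
    ∫⁻ y, ENNReal.ofReal (Real.exp (-s * ‖y‖ ^ 2)) ∂(complexNormal v) =
      ENNReal.ofReal (1 / (1 + s * v)) := by
  have hv' : 0 < v / (1 + s * v) := by positivity
  have hm : Measurable fun y => ENNReal.ofReal (complexNormalPDF v y) :=
    (measurable_complexNormalPDF v).ennreal_ofReal
  rw [complexNormal_eq_withDensity hv, lintegral_withDensity_eq_lintegral_mul _ hm (by fun_prop)]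
  have key : ∀ y : ℂ, ((fun y : ℂ => ENNReal.ofReal (complexNormalPDF v y)) *
      fun y : ℂ => ENNReal.ofReal (Real.exp (-s * ‖y‖ ^ 2))) y =
      ENNReal.ofReal (1 / (1 + s * v)) *
        ENNReal.ofReal (complexNormalPDF (v / (1 + s * v)) y) := by
    intro y
    rw [Pi.mul_apply, ← ENNReal.ofReal_mul (complexNormalPDF_nonneg hv y),
      ← ENNReal.ofReal_mul (by positivity)]
    congr 1
    unfold complexNormalPDF
    rw [mul_assoc, ← Real.exp_add, ← mul_assoc]
    have hpi := Real.pi_pos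
    have hs' : 1 + s * v ≠ 0 := hs.ne'
    congr 1
    · rw [one_div_mul_one_div]
      rw [mul_left_comm, mul_div_assoc', mul_div_cancel_left₀ _ hs']
    · congr 1
      field_simp
      ring
  simp_rw [key]
  rw [lintegral_const_mul _ (measurable_complexNormalPDF _).ennreal_ofReal,
    lintegral_complexNormalPDF hv', mul_one]

theorem integrable_exp_neg_mul_sq_norm {v s : ℝ} (hv : 0 < v) (hs : 0 < 1 + s * v) :
    Integrable (fun y : ℂ => Real.exp (-s * ‖y‖ ^ 2)) (complexNormal v) := by
  refine ⟨by fun_prop, ?_⟩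
  rw [hasFiniteIntegral_iff_ofReal (ae_of_all _ fun y => (Real.exp_pos _).le),
    lintegral_exp_neg_mul_sq_norm hv hs]
  exact ENNReal.ofReal_lt_top

theorem integral_exp_neg_mul_sq_norm {v s : ℝ} (hv : 0 < v) (hs : 0 < 1 + s * v) :
    ∫ y : ℂ, Real.exp (-s * ‖y‖ ^ 2) ∂(complexNormal v) = 1 / (1 + s * v) := by
  rw [integral_eq_lintegral_of_nonneg_ae (ae_of_all _ fun y => (Real.exp_pos _).le) (by fun_prop),
    lintegral_exp_neg_mul_sq_norm hv hs, ENNReal.toReal_ofReal (by positivity)]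

theorem integrable_sq_norm {v : ℝ} (hv : 0 < v) :
    Integrable (fun y : ℂ => ‖y‖ ^ 2) (complexNormal v) := by
  have h := (integrable_exp_neg_mul_sq_norm (s := -(1 / (2 * v))) hv
    (by field_simp; norm_num)).const_mul (2 * v)
  refine h.mono' (by fun_prop) (ae_of_all _ fun y => ?_)
  rw [Real.norm_of_nonneg (by positivity)]
  have h1 := Real.add_one_le_exp (-(-(1 / (2 * v))) * ‖y‖ ^ 2)
  have h2 : ‖y‖ ^ 2 = 2 * v * (-(-(1 / (2 * v))) * ‖y‖ ^ 2) := by field_simp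
  have h3 : 2 * v * (-(-(1 / (2 * v))) * ‖y‖ ^ 2) ≤
      2 * v * Real.exp (-(-(1 / (2 * v))) * ‖y‖ ^ 2) :=
    mul_le_mul_of_nonneg_left (by linarith) (by positivity)
  linarith

theorem integral_sq_norm {v : ℝ} (hv : 0 < v) :
    ∫ y : ℂ, ‖y‖ ^ 2 ∂(complexNormal v) = v := by
  have hI := integrable_sq_norm hv
  have hsq : Integrable (fun x : ℝ => x ^ 2) (gaussianReal 0 (v / 2).toNNReal) :=
    (memLp_id_gaussianReal 2).integrable_sq
  have hval : ∫ x : ℝ, x ^ 2 ∂(gaussianReal 0 (v / 2).toNNReal) = v / 2 := by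
    have h := variance_fun_id_gaussianReal (μ := 0) (v := (v / 2).toNNReal)
    rw [variance_of_integral_eq_zero (by fun_prop) (by simp)] at h
    rw [h, Real.coe_toNNReal _ (by positivity)]
  rw [complexNormal, integral_map_equiv]
  have : ∀ p : ℝ × ℝ, ‖Complex.measurableEquivRealProd.symm p‖ ^ 2 = p.1 ^ 2 + p.2 ^ 2 := by
    intro p
    rw [Complex.sq_norm, Complex.measurableEquivRealProd_symm_apply, Complex.normSq_mk]
    ring
  simp_rw [this]
  rw [integral_add (hsq.comp_fst _) (hsq.comp_snd _)]
  have h1 := integral_fun_fst (μ := gaussianReal 0 (v / 2).toNNReal)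
    (ν := gaussianReal 0 (v / 2).toNNReal) (fun x : ℝ => x ^ 2)
  have h2 := integral_fun_snd (μ := gaussianReal 0 (v / 2).toNNReal)
    (ν := gaussianReal 0 (v / 2).toNNReal) (fun x : ℝ => x ^ 2)
  rw [h1, h2, hval]
  simp

theorem measurable_logLikelihoodRatio (v₀ v : ℝ) : Measurable (logLikelihoodRatio v₀ v) :=
  ((measurable_complexNormalPDF v).div (measurable_complexNormalPDF v₀)).log

theorem integrable_logLikelihoodRatio {v₀ v w : ℝ} (hv₀ : 0 < v₀) (hv : 0 < v) (hw : 0 < w) :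
    Integrable (logLikelihoodRatio v₀ w) (complexNormal v) := by
  rw [funext (logLikelihoodRatio_eq hv₀ hw)]
  exact (integrable_const _).sub ((integrable_sq_norm hv).const_mul _)

theorem klInfo_eq {v₀ v : ℝ} (hv₀ : 0 < v₀) (hv : 0 < v) :
    klInfo v₀ v = Real.log v₀ - Real.log v + v / v₀ - 1 := by
  unfold klInfo
  simp_rw [logLikelihoodRatio_eq hv₀ hv]
  rw [integral_sub (integrable_const _) ((integrable_sq_norm hv).const_mul _),
    integral_const_mul, integral_sq_norm hv]
  simp
  field_simp
  ring

/-- The inequality `ln t < t - 1` at `t = x / y` controls the logarithms; `y ≤ v₀` makes the linear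
term too small to compensate. -/
theorem klInfo_strictAntiOn {v₀ : ℝ} (hv₀ : 0 < v₀) :
    StrictAntiOn (klInfo v₀) (Set.Ioc 0 v₀) := by
  rintro x ⟨hx, -⟩ y ⟨hy, hy'⟩ hxy
  rw [klInfo_eq hv₀ hx, klInfo_eq hv₀ hy]
  have h1 := Real.log_lt_sub_one_of_pos (x := x / y) (by positivity) (by
    intro h
    rw [div_eq_one_iff_eq hy.ne'] at h
    exact hxy.ne h)
  rw [Real.log_div hx.ne' hy.ne'] at h1
  have h2 : (y - x) / v₀ ≤ (y - x) / y := by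
    apply div_le_div_of_nonneg_left _ hy hy'
    linarith
  have h3 : (y - x) / y = 1 - x / y := by field_simp
  have h4 : (y - x) / v₀ = y / v₀ - x / v₀ := by ring
  linarith

theorem klInfo_self {v₀ : ℝ} (hv₀ : 0 < v₀) : klInfo v₀ v₀ = 0 := by
  rw [klInfo_eq hv₀ hv₀, div_self hv₀.ne']
  ring

theorem klInfo_pos {v₀ v : ℝ} (hv : v ∈ Set.Ioo 0 v₀) : 0 < klInfo v₀ v := by
  have hv₀ : 0 < v₀ := hv.1.trans hv.2
  have h := klInfo_strictAntiOn hv₀ ⟨hv.1, hv.2.le⟩ ⟨hv₀, le_rfl⟩ hv.2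
  rwa [klInfo_self hv₀] at h

/-! ### The condition (∗) as a threshold. -/

theorem sub_mul_log_le_attackBound_iff {v₀ v a τ : ℝ} (hv₀ : 0 < v₀) (hv : 0 < v) :
    v - v₀ * Real.log v ≤ attackBound v₀ a τ ↔ klInfo v₀ v ≤ Real.log a⁻¹ / τ := by
  rw [klInfo_eq hv₀ hv, Real.log_inv, attackBound]
  have h : v - v₀ * Real.log v - v₀ * (1 - Real.log v₀ - Real.log a / τ) =
      v₀ * (Real.log v₀ - Real.log v + v / v₀ - 1 - -Real.log a / τ) := by
    field_simp
    ring
  rw [← sub_nonpos, h, ← sub_nonpos (b := -Real.log a / τ)]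
  constructor
  · intro h'
    by_contra! h2
    exact absurd h' (not_le.2 (mul_pos hv₀ h2))
  · intro h'
    exact mul_nonpos_of_nonneg_of_nonpos hv₀.le h'

/-- Every positive level is attained by the divergence. -/
theorem exists_klInfo_eq {v₀ c : ℝ} (hv₀ : 0 < v₀) (hc : 0 < c) :
    ∃ Q ∈ Set.Ioo 0 v₀, klInfo v₀ Q = c := by
  -- At this point the divergence is `c + x / v₀`, just above the level sought.
  set x := v₀ * Real.exp (-(c + 1)) with hx
  have hx0 : 0 < x := by positivity
  have hxv : x < v₀ := by
    rw [hx]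
    have : Real.exp (-(c + 1)) < 1 := (Real.exp_lt_exp.2 (by linarith)).trans_eq Real.exp_zero
    nlinarith
  have hcont : ContinuousOn (klInfo v₀) (Set.Icc x v₀) := by
    have h : ContinuousOn (fun v => Real.log v₀ - Real.log v + v / v₀ - 1) (Set.Icc x v₀) := by
      have : ContinuousOn Real.log (Set.Icc x v₀) :=
        Real.continuousOn_log.mono fun y hy => (hx0.trans_le hy.1).ne'
      fun_prop
    exact h.congr fun y hy => klInfo_eq hv₀ (hx0.trans_le hy.1)
  have hkx : c < klInfo v₀ x := by
    rw [klInfo_eq hv₀ hx0]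
    have h1 : Real.log x = Real.log v₀ - (c + 1) := by
      rw [hx, Real.log_mul hv₀.ne' (Real.exp_pos _).ne', Real.log_exp]
      ring
    have : 0 < x / v₀ := by positivity
    rw [h1]
    linarith
  obtain ⟨Q, hQ, hQc⟩ := intermediate_value_Ioo' hxv.le hcont
    (show c ∈ Set.Ioo (klInfo v₀ v₀) (klInfo v₀ x) from ⟨by rwa [klInfo_self hv₀], hkx⟩)
  exact ⟨Q, ⟨hx0.trans hQ.1, hQ.2⟩, hQc⟩

theorem exists_threshold {v₀ a τ : ℝ} (hv₀ : 0 < v₀) (ha : a ∈ Set.Ioo (0 : ℝ) 1) (hτ : 0 < τ) :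
    ∃ Q ∈ Set.Ioo 0 v₀, ∀ v ∈ Set.Ioc 0 v₀,
      (v - v₀ * Real.log v ≤ attackBound v₀ a τ ↔ Q ≤ v) := by
  have hA : 0 < Real.log a⁻¹ := Real.log_pos ((one_lt_inv₀ ha.1).2 ha.2)
  obtain ⟨Q, hQ, hQc⟩ := exists_klInfo_eq hv₀ (div_pos hA hτ)
  refine ⟨Q, hQ, fun v hv => ?_⟩
  rw [sub_mul_log_le_attackBound_iff hv₀ hv.1, ← hQc]
  exact (klInfo_strictAntiOn hv₀).le_iff_ge hv ⟨hQ.1, hQ.2.le⟩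

/-! ### Optional stopping for a process of bounded drift. -/

section Drift

variable {Ω : Type*} [MeasurableSpace Ω]

/-- If the drift of a process `W` is at most `J` as long as the process has not reached the
level `e`, and if `W` is at least `e` at time `N`, then the expected time needed to climb from `w₀`
to `e` is at least `(e - w₀) / J`. -/
theorem le_mul_sum_measureReal_of_drift_le {P : Measure Ω} [IsProbabilityMeasure P]
    {W : ℕ → Ω → ℝ} {w₀ e J : ℝ} {N : ℕ}
    (hmeas : ∀ n, Measurable (W n)) (hint : ∀ n, Integrable (W n) P) (h0 : ∀ ω, W 0 ω = w₀)
    (hN : ∀ ω, e ≤ W N ω)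
    (hstep : ∀ n, ∫ ω in {ω | ∀ m ≤ n, W m ω < e}, (W (n + 1) ω - W n ω) ∂P ≤
      J * P.real {ω | ∀ m ≤ n, W m ω < e}) :
    e - w₀ ≤ J * ∑ n ∈ Finset.range N, P.real {ω | ∀ m ≤ n, W m ω < e} := by
  set A : ℕ → Set Ω := fun n => {ω | ∀ m ≤ n, W m ω < e} with hA
  have hAm : ∀ n, MeasurableSet (A n) := fun n => by
    simp only [hA, Set.ofPred_forall]
    exact MeasurableSet.iInter fun m => MeasurableSet.iInter fun _ =>
      measurableSet_lt (hmeas m) measurable_const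
  have hanti : ∀ n, A (n + 1) ⊆ A n := fun n ω hω m hm => hω m (hm.trans n.le_succ)
  have key : ∀ n, e - w₀ ≤ ∫ ω in A n, (e - W n ω) ∂P +
      J * ∑ i ∈ Finset.range n, P.real (A i) := by
    intro n
    induction n with
    | zero =>
      simp only [h0, integral_const, Finset.range_zero, Finset.sum_empty, mul_zero, add_zero,
        smul_eq_mul, measureReal_restrict_apply_univ]
      by_cases h : w₀ < e
      · have : A 0 = Set.univ := by
          ext ω
          simp [hA, h0, h]
        simp [this]
      · have : A 0 = ∅ := by
          ext ω
          simp [hA, h0, h]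
        simpa [this] using h
    | succ n ih =>
      have h1 : ∫ ω in A n, (e - W n ω) ∂P = ∫ ω in A n, (e - W (n + 1) ω) ∂P +
          ∫ ω in A n, (W (n + 1) ω - W n ω) ∂P := by
        rw [← integral_add]
        · refine integral_congr_ae (ae_of_all _ fun ω => ?_)
          simp
        · exact ((integrable_const _).sub (hint _)).integrableOn
        · exact ((hint _).sub (hint _)).integrableOn
      -- On `A n \ A (n + 1)` the level has just been reached, so the discarded integrand is
      -- nonpositive.
      have h2 : ∫ ω in A n, (e - W (n + 1) ω) ∂P ≤ ∫ ω in A (n + 1), (e - W (n + 1) ω) ∂P := by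
        rw [← integral_indicator (hAm _), ← integral_indicator (hAm _)]
        refine integral_mono (((integrable_const _).sub (hint _)).indicator (hAm _))
          (((integrable_const _).sub (hint _)).indicator (hAm _)) fun ω => ?_
        by_cases hω : ω ∈ A n
        · by_cases hω' : ω ∈ A (n + 1)
          · simp [hω, hω']
          · simp only [Set.indicator_of_mem hω, Set.indicator_of_notMem hω']
            by_contra! h
            refine hω' fun m hm => ?_
            rcases Nat.le_succ_iff.1 hm with h' | rfl
            · exact hω m h'
            · simpa using h
        · simp [hω, Set.indicator_of_notMem fun h => hω (hanti n h)]
      have h3 := hstep n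
      rw [Finset.sum_range_succ, mul_add]
      linarith
  have h := key N
  have hempty : A N = ∅ := by
    ext ω
    simp only [hA, Set.mem_ofPred_eq, Set.mem_empty_iff_false, iff_false, not_forall, not_lt]
    exact ⟨N, le_rfl, hN ω⟩
  rw [hempty] at h
  simpa using h

end Drift

/-! ### Independent sequences: random walk plus product supermartingales. -/

section Sequence

variable {E : Type*} [MeasurableSpace E]

/-- The σ-algebra generated by the coordinates up to time `n`. -/
abbrev pastSigma (E : Type*) [MeasurableSpace E] (n : ℕ) : MeasurableSpace (ℕ → E) :=
  MeasurableSpace.comap (fun (y : ℕ → E) (i : Finset.range (n + 1)) => y i) inferInstance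

theorem pastSigma_le (n : ℕ) : pastSigma E n ≤ MeasurableSpace.pi :=
  Measurable.comap_le (measurable_pi_lambda _ fun _ => measurable_pi_apply _)

theorem measurable_coord_pastSigma {i n : ℕ} (h : i ≤ n) :
    Measurable[pastSigma E n] fun y : ℕ → E => y i :=
  (measurable_pi_apply (⟨i, Finset.mem_range.2 (by omega)⟩ : Finset.range (n + 1))).comp
    (comap_measurable fun (y : ℕ → E) (i : Finset.range (n + 1)) => y i)

variable {μ : Measure E} [IsProbabilityMeasure μ]

theorem indepFun_past_next {n : ℕ} {F : (ℕ → E) → ℝ} (hF : Measurable[pastSigma E n] F)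
    {h : E → ℝ} (hh : Measurable h) :
    IndepFun F (fun y => h (y (n + 1))) (Measure.infinitePi fun _ : ℕ => μ) := by
  have hind : iIndepFun (fun (i : ℕ) (y : ℕ → E) => y i) (Measure.infinitePi fun _ : ℕ => μ) :=
    iIndepFun_infinitePi (X := fun _ e => e) fun _ => measurable_id
  have h1 := hind.indepFun_finset (Finset.range (n + 1)) {n + 1} (by simp)
    fun i => measurable_pi_apply i
  rw [IndepFun_iff_Indep] at h1 ⊢
  refine indep_of_indep_of_le_left (indep_of_indep_of_le_right h1 ?_) (measurable_iff_comap_le.1 hF)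
  refine measurable_iff_comap_le.1 ?_
  exact hh.comp ((measurable_pi_apply (⟨n + 1, by simp⟩ : ({n + 1} : Finset ℕ))).comp
    (comap_measurable fun (y : ℕ → E) (i : ({n + 1} : Finset ℕ)) => y i))

theorem integrable_coord {h : E → ℝ} (hh : Integrable h μ) (i : ℕ) :
    Integrable (fun y : ℕ → E => h (y i)) (Measure.infinitePi fun _ : ℕ => μ) :=
  (measurePreserving_eval_infinitePi (fun _ : ℕ => μ) i).integrable_comp_of_integrable hh

theorem integral_coord {h : E → ℝ} (hh : Measurable h) (i : ℕ) :
    ∫ y : ℕ → E, h (y i) ∂(Measure.infinitePi fun _ : ℕ => μ) = ∫ x, h x ∂μ := by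
  have hp := measurePreserving_eval_infinitePi (fun _ : ℕ => μ) i
  have h1 := integral_map (μ := Measure.infinitePi fun _ : ℕ => μ) hp.measurable.aemeasurable
    (hp.map_eq ▸ hh.aestronglyMeasurable : AEStronglyMeasurable h _)
  rw [hp.map_eq] at h1
  exact h1.symm

theorem integrable_mul_next {n : ℕ} {F : (ℕ → E) → ℝ} (hF : Measurable[pastSigma E n] F)
    (hFi : Integrable F (Measure.infinitePi fun _ : ℕ => μ)) {h : E → ℝ} (hh : Measurable h)
    (hhi : Integrable h μ) :
    Integrable (fun y => F y * h (y (n + 1))) (Measure.infinitePi fun _ : ℕ => μ) :=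
  (indepFun_past_next hF hh).integrable_mul hFi (integrable_coord hhi _)

theorem integral_mul_next {n : ℕ} {F : (ℕ → E) → ℝ} (hF : Measurable[pastSigma E n] F)
    {h : E → ℝ} (hh : Measurable h) :
    ∫ y, F y * h (y (n + 1)) ∂(Measure.infinitePi fun _ : ℕ => μ) =
      (∫ y, F y ∂(Measure.infinitePi fun _ : ℕ => μ)) * ∫ x, h x ∂μ := by
  rw [(indepFun_past_next hF hh).integral_fun_mul_eq_mul_integral
    (hF.mono (pastSigma_le n) le_rfl).aestronglyMeasurable
    (hh.comp (measurable_pi_apply _)).aestronglyMeasurable, integral_coord hh]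

theorem setIntegral_mul_next {n : ℕ} {s : Set (ℕ → E)} (hs : MeasurableSet[pastSigma E n] s)
    {F : (ℕ → E) → ℝ} (hF : Measurable[pastSigma E n] F) {h : E → ℝ} (hh : Measurable h) :
    ∫ y in s, F y * h (y (n + 1)) ∂(Measure.infinitePi fun _ : ℕ => μ) =
      (∫ y in s, F y ∂(Measure.infinitePi fun _ : ℕ => μ)) * ∫ x, h x ∂μ := by
  rw [← integral_indicator (pastSigma_le n _ hs), ← integral_indicator (pastSigma_le n _ hs),
    ← integral_mul_next (hF.indicator hs) hh]
  refine integral_congr_ae (ae_of_all _ fun y => ?_)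
  by_cases hy : y ∈ s <;> simp [hy]

variable {α : Type*}

/-- A random walk plus a linear combination of products of functions of the single symbols. -/
def walkPlusProducts (X : E → ℝ) (g : α → ℕ → E → ℝ) (s : Finset α) (β : α → ℝ) (K κ : ℝ) (n : ℕ)
    (y : ℕ → E) : ℝ :=
  K + ∑ i ∈ Finset.Ioc 0 n, X (y i) + κ * ∑ a ∈ s, β a * ∏ i ∈ Finset.Ioc 0 n, g a i (y i)

theorem measurable_prod_past {g : ℕ → E → ℝ} (hg : ∀ i, Measurable (g i)) (n : ℕ) :
    Measurable[pastSigma E n] fun y => ∏ i ∈ Finset.Ioc 0 n, g i (y i) :=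
  Finset.measurable_prod _ fun i hi =>
    (hg i).comp (measurable_coord_pastSigma (Finset.mem_Ioc.1 hi).2)

theorem integrable_prod_past {g : ℕ → E → ℝ} (hg : ∀ i, Measurable (g i))
    (hgi : ∀ i, Integrable (g i) μ) (n : ℕ) :
    Integrable (fun y => ∏ i ∈ Finset.Ioc 0 n, g i (y i)) (Measure.infinitePi fun _ : ℕ => μ) := by
  induction n with
  | zero => simp
  | succ n ih =>
    simp_rw [Finset.prod_Ioc_succ_top (Nat.zero_le n)]
    exact integrable_mul_next (measurable_prod_past hg n) ih (hg _) (hgi _)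

theorem measurable_walkPlusProducts {X : E → ℝ} (hX : Measurable X) {g : α → ℕ → E → ℝ}
    (hg : ∀ a i, Measurable (g a i)) (s : Finset α) (β : α → ℝ) (K κ : ℝ) {m n : ℕ} (h : m ≤ n) :
    Measurable[pastSigma E n] (walkPlusProducts X g s β K κ m) := by
  have hc : ∀ i ∈ Finset.Ioc 0 m, Measurable[pastSigma E n] fun y : ℕ → E => y i :=
    fun i hi => measurable_coord_pastSigma ((Finset.mem_Ioc.1 hi).2.trans h)
  refine Measurable.add (Measurable.add measurable_const ?_) (Measurable.const_mul ?_ _)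
  · exact Finset.measurable_sum _ fun i hi => hX.comp (hc i hi)
  · exact Finset.measurable_sum _ fun a _ => Measurable.const_mul
      (Finset.measurable_prod _ fun i hi => (hg a i).comp (hc i hi)) _

theorem integrable_walkPlusProducts {X : E → ℝ} (hXi : Integrable X μ)
    {g : α → ℕ → E → ℝ} (hg : ∀ a i, Measurable (g a i)) (hgi : ∀ a i, Integrable (g a i) μ)
    (s : Finset α) (β : α → ℝ) (K κ : ℝ) (n : ℕ) :
    Integrable (walkPlusProducts X g s β K κ n) (Measure.infinitePi fun _ : ℕ => μ) := by
  refine Integrable.add (Integrable.add (integrable_const _) ?_) (Integrable.const_mul ?_ _)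
  · exact integrable_finsetSum _ fun i _ => integrable_coord hXi i
  · exact integrable_finsetSum _ fun a _ => (integrable_prod_past (hg a) (hgi a) n).const_mul _

/-- The new symbol is independent of the past event `S`: the walk gains at most `J` per unit of mass
of `S`, and each product is multiplied by an independent factor of mean at most `1`, so it cannot
grow on average. -/
theorem setIntegral_walkPlusProducts_sub_le {X : E → ℝ} (hX : Measurable X) (hXi : Integrable X μ)
    {J : ℝ} (hXJ : ∫ x, X x ∂μ ≤ J)
    {g : α → ℕ → E → ℝ} (hg : ∀ a i, Measurable (g a i)) (hgi : ∀ a i, Integrable (g a i) μ)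
    (hg0 : ∀ a i x, 0 ≤ g a i x) (hg1 : ∀ a i, ∫ x, g a i x ∂μ ≤ 1)
    (s : Finset α) {β : α → ℝ} (hβ : ∀ a, 0 ≤ β a) (K : ℝ) {κ : ℝ} (hκ : 0 ≤ κ) {n : ℕ}
    {S : Set (ℕ → E)} (hS : MeasurableSet[pastSigma E n] S) :
    ∫ y in S, (walkPlusProducts X g s β K κ (n + 1) y - walkPlusProducts X g s β K κ n y)
      ∂(Measure.infinitePi fun _ : ℕ => μ) ≤ J * (Measure.infinitePi fun _ : ℕ => μ).real S := by
  set P := Measure.infinitePi fun _ : ℕ => μ with hP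
  have hdiff : ∀ y, walkPlusProducts X g s β K κ (n + 1) y - walkPlusProducts X g s β K κ n y =
      X (y (n + 1)) + ∑ a ∈ s, κ * β a *
        ((∏ i ∈ Finset.Ioc 0 n, g a i (y i)) * g a (n + 1) (y (n + 1)) -
          ∏ i ∈ Finset.Ioc 0 n, g a i (y i)) := by
    intro y
    simp only [walkPlusProducts, Finset.sum_Ioc_succ_top (Nat.zero_le n),
      Finset.prod_Ioc_succ_top (Nat.zero_le n), Finset.mul_sum, mul_sub, Finset.sum_sub_distrib,
      mul_assoc]
    ring
  simp_rw [hdiff]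
  have hi1 : ∀ a, Integrable (fun y => (∏ i ∈ Finset.Ioc 0 n, g a i (y i)) *
      g a (n + 1) (y (n + 1))) P := fun a =>
    integrable_mul_next (measurable_prod_past (hg a) n) (integrable_prod_past (hg a) (hgi a) n)
      (hg a _) (hgi a _)
  have hi2 : ∀ a, Integrable (fun y => ∏ i ∈ Finset.Ioc 0 n, g a i (y i)) P := fun a =>
    integrable_prod_past (hg a) (hgi a) n
  have hi3 : ∀ a, Integrable (fun y => κ * β a *
      ((∏ i ∈ Finset.Ioc 0 n, g a i (y i)) * g a (n + 1) (y (n + 1)) -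
        ∏ i ∈ Finset.Ioc 0 n, g a i (y i))) (P.restrict S) := fun a =>
    (((hi1 a).sub (hi2 a)).const_mul _).integrableOn
  rw [integral_add (integrable_coord hXi _).integrableOn (integrable_finsetSum _ fun a _ => hi3 a),
    integral_finsetSum _ fun a _ => hi3 a]
  have hXS : ∫ y in S, X (y (n + 1)) ∂P ≤ J * P.real S := by
    have h := setIntegral_mul_next (μ := μ) hS (F := fun _ => 1) measurable_const hX
    simp only [one_mul, integral_const, smul_eq_mul, mul_one, measureReal_restrict_apply_univ] at h
    rw [hP, h, mul_comm]
    exact mul_le_mul_of_nonneg_right hXJ measureReal_nonneg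
  have hsum : ∑ a ∈ s, ∫ y in S, κ * β a *
        ((∏ i ∈ Finset.Ioc 0 n, g a i (y i)) * g a (n + 1) (y (n + 1)) -
          ∏ i ∈ Finset.Ioc 0 n, g a i (y i)) ∂P ≤ 0 := by
    refine Finset.sum_nonpos fun a _ => ?_
    rw [integral_const_mul, integral_sub (hi1 a).integrableOn (hi2 a).integrableOn]
    refine mul_nonpos_of_nonneg_of_nonpos (mul_nonneg hκ (hβ a)) (sub_nonpos.2 ?_)
    rw [setIntegral_mul_next hS (measurable_prod_past (hg a) n) (hg a _)]
    exact mul_le_of_le_one_right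
      (integral_nonneg fun y => Finset.prod_nonneg fun i _ => hg0 a i _) (hg1 a _)
  linarith

theorem le_mul_sum_measureReal_walkPlusProducts {X : E → ℝ} (hX : Measurable X)
    (hXi : Integrable X μ) {J : ℝ} (hXJ : ∫ x, X x ∂μ ≤ J)
    {g : α → ℕ → E → ℝ} (hg : ∀ a i, Measurable (g a i)) (hgi : ∀ a i, Integrable (g a i) μ)
    (hg0 : ∀ a i x, 0 ≤ g a i x) (hg1 : ∀ a i, ∫ x, g a i x ∂μ ≤ 1)
    (s : Finset α) {β : α → ℝ} (hβ : ∀ a, 0 ≤ β a) (K : ℝ) {κ : ℝ} (hκ : 0 ≤ κ) {N : ℕ} {e : ℝ}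
    (hN : ∀ y, e ≤ walkPlusProducts X g s β K κ N y) :
    e - (K + κ * ∑ a ∈ s, β a) ≤ J * ∑ n ∈ Finset.range N,
      (Measure.infinitePi fun _ : ℕ => μ).real
        {y | ∀ m ≤ n, walkPlusProducts X g s β K κ m y < e} := by
  refine le_mul_sum_measureReal_of_drift_le (fun n => ?_)
    (integrable_walkPlusProducts hXi hg hgi s β K κ) (fun y => ?_) hN fun n => ?_
  · exact (measurable_walkPlusProducts hX hg s β K κ le_rfl).mono (pastSigma_le n) le_rfl
  · simp [walkPlusProducts]
  · refine setIntegral_walkPlusProducts_sub_le hX hXi hXJ hg hgi hg0 hg1 s hβ K hκ ?_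
    simp only [Set.ofPred_forall]
    exact MeasurableSet.iInter fun m => MeasurableSet.iInter fun hm =>
      measurableSet_lt (measurable_walkPlusProducts hX hg s β K κ hm) measurable_const

end Sequence

/-! ### Expected time as a sum of tail probabilities. -/

theorem card_filter_le_of_lt (τ : ℕ∞) (N : ℕ) (p : ℕ → Prop) [DecidablePred p]
    (h : ∀ n < N, p n → (n : ℕ∞) < τ) : (((Finset.range N).filter p).card : ℕ∞) ≤ τ := by
  induction τ using ENat.recTopCoe with
  | top => exact le_top
  | coe t =>
    norm_cast
    calc ((Finset.range N).filter p).card ≤ (Finset.range t).card := by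
          refine Finset.card_le_card fun n hn => ?_
          rw [Finset.mem_filter, Finset.mem_range] at hn
          exact Finset.mem_range.2 (by exact_mod_cast h n hn.1 hn.2)
      _ = t := Finset.card_range t

/-- Pointwise, the number of `n < N` with `ω ∈ A n` is at most `τ ω`. Only monotonicity of the
integral is applied to `τ`, so its measurability is not needed. -/
theorem ofReal_sum_measureReal_le_lintegral {Ω : Type*} [MeasurableSpace Ω] {P : Measure Ω}
    [IsProbabilityMeasure P] {τ : Ω → ℕ∞} {N : ℕ} {A : ℕ → Set Ω}
    (hA : ∀ n, MeasurableSet (A n)) (h : ∀ n < N, ∀ ω ∈ A n, (n : ℕ∞) < τ ω) :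
    ENNReal.ofReal (∑ n ∈ Finset.range N, P.real (A n)) ≤ ∫⁻ ω, (τ ω : ℝ≥0∞) ∂P := by
  classical
  rw [ENNReal.ofReal_sum_of_nonneg fun _ _ => measureReal_nonneg]
  rw [Finset.sum_congr rfl fun n _ => ofReal_measureReal (measure_ne_top P (A n))]
  have h1 : ∑ n ∈ Finset.range N, P (A n) =
      ∫⁻ ω, ∑ n ∈ Finset.range N, (A n).indicator 1 ω ∂P := by
    rw [lintegral_finsetSum _ fun n _ => measurable_one.indicator (hA n)]
    simp_rw [lintegral_indicator_one (hA _)]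
  rw [h1]
  refine lintegral_mono fun ω => ?_
  have h2 := card_filter_le_of_lt (τ ω) N (fun n => ω ∈ A n) fun n hn hω => h n hn ω hω
  simp only [Set.indicator_apply, Pi.one_apply, Finset.sum_boole]
  exact_mod_cast ENat.toENNReal_le.2 h2

/-! ### The dominating process and the detection time. -/

section Detection

variable {E : Type*}

/-- The likelihood factor at time `i` of the hypothesis that the increments follow the `j`-th
alternative after the time `k`. -/
noncomputable def tiltedFactor (X : E → ℝ) (ℓ : ℕ → E → ℝ) (θ ρ : ℝ) (a : ℕ × ℕ) (i : ℕ) (x : E) : ℝ :=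
  if i ≤ a.2 then Real.exp (-θ * X x) / ρ else Real.exp (θ * (ℓ a.1 x - X x))

/-- The weight `ρ ^ k` cancels the normalisations before `k`; this is what turns products of factors
back into the comparison of a sum after `k` with the walk. -/
theorem pow_mul_prod_tiltedFactor (X : E → ℝ) (ℓ : ℕ → E → ℝ) (θ : ℝ) {ρ : ℝ} (hρ : 0 < ρ)
    {j k t : ℕ} (hkt : k ≤ t) (y : ℕ → E) :
    ρ ^ k * ∏ i ∈ Finset.Ioc 0 t, tiltedFactor X ℓ θ ρ (j, k) i (y i) =
      Real.exp (θ * (∑ i ∈ Finset.Ioc k t, ℓ j (y i) - ∑ i ∈ Finset.Ioc 0 t, X (y i))) := by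
  rw [← Finset.prod_Ioc_consecutive _ (Nat.zero_le k) hkt,
    ← Finset.sum_Ioc_consecutive _ (Nat.zero_le k) hkt]
  have h1 : ∏ i ∈ Finset.Ioc 0 k, tiltedFactor X ℓ θ ρ (j, k) i (y i) =
      Real.exp (-θ * ∑ i ∈ Finset.Ioc 0 k, X (y i)) / ρ ^ k := by
    rw [Finset.mul_sum, Real.exp_sum]
    calc _ = ∏ i ∈ Finset.Ioc 0 k, Real.exp (-θ * X (y i)) / ρ :=
          Finset.prod_congr rfl fun i hi => if_pos (Finset.mem_Ioc.1 hi).2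
      _ = _ := by simp [Finset.prod_div_distrib]
  have h2 : ∏ i ∈ Finset.Ioc k t, tiltedFactor X ℓ θ ρ (j, k) i (y i) =
      Real.exp (θ * ∑ i ∈ Finset.Ioc k t, (ℓ j (y i) - X (y i))) := by
    rw [Finset.mul_sum, Real.exp_sum]
    exact Finset.prod_congr rfl fun i hi => if_neg (Finset.mem_Ioc.1 hi).1.not_ge
  rw [h1, h2, ← mul_assoc, mul_div_cancel₀ _ (pow_pos hρ k).ne', ← Real.exp_add,
    Finset.sum_sub_distrib]
  congr 1
  ring

variable [MeasurableSpace E] {μ : Measure E} [IsProbabilityMeasure μ]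

/-- A lower bound on the expectation of a random time before which no alternative after any change
point accumulates `e - K`. -/
theorem exists_le_lintegral_detectionTime {X : E → ℝ} (hX : Measurable X) (hXi : Integrable X μ)
    {J : ℝ} (hXJ : ∫ x, X x ∂μ ≤ J) {ℓ : ℕ → E → ℝ} (hℓ : ∀ j, Measurable (ℓ j)) {θ ρ : ℝ}
    (hθ : 0 < θ) (hρ0 : 0 < ρ) (hρ1 : ρ < 1)
    (hi1 : Integrable (fun x => Real.exp (-θ * X x)) μ) (h1 : ∫ x, Real.exp (-θ * X x) ∂μ ≤ ρ)
    (hi2 : ∀ j, Integrable (fun x => Real.exp (θ * (ℓ j x - X x))) μ)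
    (h2 : ∀ j, ∫ x, Real.exp (θ * (ℓ j x - X x)) ∂μ ≤ 1)
    {N m : ℕ} (hN : 0 < N) (hm : 0 < m) {e K : ℝ} (he : 0 ≤ e) (hK : 0 ≤ K)
    (heN : Real.exp (θ * e) * ρ ^ N ≤ 1) {τ : (ℕ → E) → ℕ∞}
    (hτ : ∀ y, ∀ n < N, τ y ≤ n → ∃ t ≤ n, ∃ k ∈ Set.Icc 1 t, ∃ j < m,
      e - K ≤ ∑ i ∈ Finset.Ioc k t, ℓ j (y i)) :
    ∃ R : ℝ, ENNReal.ofReal R ≤ ∫⁻ y, (τ y : ℝ≥0∞) ∂(Measure.infinitePi fun _ : ℕ => μ) ∧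
      e - K - 1 / θ * (Real.log (m / (1 - ρ)) + 1) ≤ J * R := by
  set g : ℕ × ℕ → ℕ → E → ℝ := tiltedFactor X ℓ θ ρ with hg
  set c : ℝ := m / (1 - ρ) with hc
  -- The extra weight at `k = N` forces the process above `e` at the deadline `N`, so that the
  -- stopping is bounded.
  set β : ℕ × ℕ → ℝ := fun a => ρ ^ a.2 * if a.2 = N then Real.exp (θ * e) else 1 with hβ
  set s : Finset (ℕ × ℕ) := Finset.range m ×ˢ Finset.Icc 1 N with hs
  have hm' : (0 : ℝ) < m := by exact_mod_cast hm
  have hc0 : 0 < c := div_pos hm' (by linarith)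
  have hβ0 : ∀ a, 0 ≤ β a := fun a => by
    simp only [hβ]
    positivity
  have hg0 : ∀ a i x, 0 < g a i x := fun a i x => by
    simp only [hg, tiltedFactor]
    split_ifs <;> positivity
  have hge1 : ∀ a i, i ≤ a.2 → g a i = fun x => Real.exp (-θ * X x) / ρ :=
    fun a i h => funext fun x => if_pos h
  have hge2 : ∀ a i, ¬ i ≤ a.2 → g a i = fun x => Real.exp (θ * (ℓ a.1 x - X x)) :=
    fun a i h => funext fun x => if_neg h
  have hgm : ∀ a i, Measurable (g a i) := fun a i => by
    by_cases h : i ≤ a.2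
    · rw [hge1 a i h]
      fun_prop
    · rw [hge2 a i h]
      fun_prop
  have hgi : ∀ a i, Integrable (g a i) μ := fun a i => by
    by_cases h : i ≤ a.2
    · rw [hge1 a i h]
      exact hi1.div_const _
    · rw [hge2 a i h]
      exact hi2 _
  have hg1 : ∀ a i, ∫ x, g a i x ∂μ ≤ 1 := fun a i => by
    by_cases h : i ≤ a.2
    · rw [hge1 a i h]
      rw [integral_div]
      exact (div_le_one hρ0).2 h1
    · rw [hge2 a i h]
      exact h2 _
  have hβsum : ∑ a ∈ s, β a ≤ c := by
    have hk : ∑ k ∈ Finset.Icc 1 N, ρ ^ k * (if k = N then Real.exp (θ * e) else 1) ≤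
        (1 - ρ)⁻¹ := by
      -- By `heN` the boosted term at `k = N` is at most `1`, and it takes the vacant place of `ρ ^
      -- 0` in the geometric series.
      calc _ ≤ ∑ k ∈ Finset.Icc 1 N, (ρ ^ k + if k = N then 1 else 0) := by
            refine Finset.sum_le_sum fun k _ => ?_
            have := pow_pos hρ0 k
            split_ifs with h
            · subst h
              linarith
            · linarith
        _ = ∑ k ∈ insert 0 (Finset.Icc 1 N), ρ ^ k := by
            rw [Finset.sum_insert (by simp), Finset.sum_add_distrib, Finset.sum_ite_eq',
              if_pos (Finset.mem_Icc.2 ⟨hN, le_rfl⟩), pow_zero, add_comm]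
        _ ≤ ∑' k : ℕ, ρ ^ k := (summable_geometric_of_lt_one hρ0.le hρ1).sum_le_tsum _
            fun k _ => (pow_pos hρ0 k).le
        _ = _ := tsum_geometric_of_lt_one hρ0.le hρ1
    rw [hs, Finset.sum_product]
    change ∑ _ ∈ Finset.range m, ∑ k ∈ Finset.Icc 1 N,
      ρ ^ k * (if k = N then Real.exp (θ * e) else 1) ≤ c
    rw [Finset.sum_const, Finset.card_range, nsmul_eq_mul, hc, div_eq_mul_inv]
    exact mul_le_mul_of_nonneg_left hk hm'.le
  set W := walkPlusProducts X g s β (K + 1 / θ * Real.log c) (1 / (θ * c)) with hW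
  have hlow : ∀ (y : ℕ → E) (t : ℕ), ∀ a ∈ s, ∀ r : ℝ,
      Real.exp (θ * (r - ∑ i ∈ Finset.Ioc 0 t, X (y i))) ≤
        β a * ∏ i ∈ Finset.Ioc 0 t, g a i (y i) → K + r ≤ W t y := by
    intro y t a ha r hr
    have h3 : β a * ∏ i ∈ Finset.Ioc 0 t, g a i (y i) ≤
        ∑ a ∈ s, β a * ∏ i ∈ Finset.Ioc 0 t, g a i (y i) :=
      Finset.single_le_sum (f := fun a => β a * ∏ i ∈ Finset.Ioc 0 t, g a i (y i))
        (fun b _ => mul_nonneg (hβ0 b) (Finset.prod_nonneg fun i _ => (hg0 b i _).le)) ha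
    set z := Real.exp (θ * (r - ∑ i ∈ Finset.Ioc 0 t, X (y i))) with hz
    set Z := ∑ a ∈ s, β a * ∏ i ∈ Finset.Ioc 0 t, g a i (y i) with hZ
    have hz0 : 0 < z := Real.exp_pos _
    -- The tangent of the logarithm at `c`: a linear function of the mixture, hence still of
    -- controlled drift, replaces its logarithm.
    have h4 := Real.log_le_sub_one_of_pos (div_pos hz0 hc0)
    rw [Real.log_div hz0.ne' hc0.ne', hz, Real.log_exp, ← hz] at h4
    have h5 : z / c ≤ Z / c := div_le_div_of_nonneg_right (hr.trans h3) hc0.le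
    have h6 : r - ∑ i ∈ Finset.Ioc 0 t, X (y i) ≤ 1 / θ * (Real.log c + Z / c) := by
      rw [one_div, ← div_eq_inv_mul, le_div_iff₀ hθ]
      linarith
    have h7 : 1 / θ * (Real.log c + Z / c) = 1 / θ * Real.log c + 1 / (θ * c) * Z := by
      field_simp
    simp only [hW, walkPlusProducts]
    linarith
  have hWN : ∀ y, e ≤ W N y := by
    intro y
    -- With `k = t = N` the sum after the change is empty, so the index `0` of the alternative is
    -- immaterial.
    have := hlow y N (0, N) (by simp [hs, hm]; omega) e (by
      have h3 := pow_mul_prod_tiltedFactor X ℓ θ hρ0 (j := 0) (le_refl N) y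
      simp only [hβ, if_true, hg]
      rw [mul_right_comm, h3, ← Real.exp_add]
      simp only [Finset.Ioc_self, Finset.sum_empty]
      rw [Real.exp_le_exp]
      exact (by ring : θ * (e - _) = _).le)
    linarith
  have hmain := le_mul_sum_measureReal_walkPlusProducts hX hXi hXJ hgm hgi
    (fun a i x => (hg0 a i x).le) hg1 s hβ0 (K + 1 / θ * Real.log c)
    (κ := 1 / (θ * c)) (by positivity) hWN
  refine ⟨_, ofReal_sum_measureReal_le_lintegral (N := N)
    (A := fun n => {y | ∀ m ≤ n, W m y < e}) (fun n => ?_) ?_, le_trans ?_ hmain⟩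
  · simp only [Set.ofPred_forall]
    exact MeasurableSet.iInter fun m => MeasurableSet.iInter fun hm =>
      measurableSet_lt ((measurable_walkPlusProducts hX hgm s β _ _ le_rfl).mono (pastSigma_le m)
        le_rfl) measurable_const
  · intro n hn y hy
    by_contra! h
    obtain ⟨t, htn, k, ⟨hk1, hkt⟩, j, hj, hjk⟩ := hτ y n hn h
    refine absurd (hy t htn) (not_lt.2 ?_)
    have := hlow y t (j, k) (by
      simp only [hs, Finset.mem_product, Finset.mem_range, Finset.mem_Icc]
      omega) (∑ i ∈ Finset.Ioc k t, ℓ j (y i)) (by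
      rw [← pow_mul_prod_tiltedFactor X ℓ θ hρ0 hkt y]
      refine mul_le_mul_of_nonneg_right ?_ (Finset.prod_nonneg fun i _ => (hg0 _ i _).le)
      refine le_mul_of_one_le_right (pow_pos hρ0 k).le ?_
      split_ifs
      · exact Real.one_le_exp (by positivity)
      · exact le_rfl)
    linarith
  · have h3 : 1 / (θ * c) * ∑ a ∈ s, β a ≤ 1 / (θ * c) * c :=
      mul_le_mul_of_nonneg_left hβsum (by positivity)
    have h4 : 1 / (θ * c) * c = 1 / θ := by field_simp
    linarith

end Detection

/-! ### Exponential moments of log-likelihood ratios and Hellinger integrals. -/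

theorem integrable_exp_sub_mul_sq_norm {v s : ℝ} (c : ℝ) (hv : 0 < v) (hs : 0 < 1 + s * v) :
    Integrable (fun y : ℂ => Real.exp (c - s * ‖y‖ ^ 2)) (complexNormal v) := by
  simp_rw [sub_eq_add_neg, Real.exp_add, ← neg_mul]
  exact (integrable_exp_neg_mul_sq_norm hv hs).const_mul _

theorem integral_exp_sub_mul_sq_norm {v s : ℝ} (c : ℝ) (hv : 0 < v) (hs : 0 < 1 + s * v) :
    ∫ y : ℂ, Real.exp (c - s * ‖y‖ ^ 2) ∂(complexNormal v) = Real.exp c / (1 + s * v) := by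
  simp_rw [sub_eq_add_neg, Real.exp_add, ← neg_mul]
  rw [integral_const_mul, integral_exp_neg_mul_sq_norm hv hs, mul_one_div]

theorem one_add_mul_sub_one_pos {θ u : ℝ} (hθ : θ ∈ Set.Ioo (0 : ℝ) 1) (hu : 0 < u) :
    0 < 1 + θ * (u - 1) := by
  nlinarith [hθ.1, hθ.2, mul_pos hθ.1 hu]

/-- The Hellinger integral of order `θ` of `CN(0, w)` and `CN(0, v)`, as a function of `v / w`. -/
noncomputable def hellinger (θ u : ℝ) : ℝ := u ^ θ / (1 + θ * (u - 1))

/-- Bernoulli's inequality `u ^ θ ≤ 1 + θ (u - 1)`; its strict form gives the strict bound for `u ≠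
1`. -/
theorem hellinger_le_one {θ u : ℝ} (hθ : θ ∈ Set.Ioo (0 : ℝ) 1) (hu : 0 < u) :
    hellinger θ u ≤ 1 := by
  rw [hellinger, div_le_one (one_add_mul_sub_one_pos hθ hu)]
  have h := rpow_one_add_le_one_add_mul_self (s := u - 1) (by linarith) hθ.1.le hθ.2.le
  rwa [add_sub_cancel] at h

theorem hellinger_lt_one {θ u : ℝ} (hθ : θ ∈ Set.Ioo (0 : ℝ) 1) (hu : 0 < u) (hu1 : u ≠ 1) :
    hellinger θ u < 1 := by
  rw [hellinger, div_lt_one (one_add_mul_sub_one_pos hθ hu)]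
  have h := rpow_one_add_lt_one_add_mul_self (s := u - 1) (by linarith) (sub_ne_zero.2 hu1)
    hθ.1 hθ.2
  rwa [add_sub_cancel] at h

theorem exists_hellinger_le {θ p q : ℝ} (hθ : θ ∈ Set.Ioo (0 : ℝ) 1) (hp : 0 < p) (hq : q < 1) :
    ∃ ρ < 1, ∀ u ∈ Set.Icc p q, hellinger θ u ≤ ρ := by
  rcases (Set.Icc p q).eq_empty_or_nonempty with h | h
  · exact ⟨0, one_pos, by simp [h]⟩
  have hcont : ContinuousOn (hellinger θ) (Set.Icc p q) := by
    unfold hellinger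
    refine ContinuousOn.div (continuousOn_id.rpow_const fun x hx => Or.inr hθ.1.le)
      (by fun_prop) fun x hx => (one_add_mul_sub_one_pos hθ (hp.trans_le hx.1)).ne'
  obtain ⟨x, hx, hmax⟩ := isCompact_Icc.exists_isMaxOn h hcont
  exact ⟨hellinger θ x, hellinger_lt_one hθ (hp.trans_le hx.1) (hx.2.trans_lt hq).ne,
    fun u hu => hmax hu⟩

section LogLikelihood

variable {v₀ v w θ : ℝ} (hv₀ : 0 < v₀) (hv : 0 < v) (hw : 0 < w) (hθ : θ ∈ Set.Ioo (0 : ℝ) 1)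
include hv₀ hv hw hθ

theorem integrable_exp_mul_logLikelihoodRatio_sub :
    Integrable (fun y => Real.exp (θ * (logLikelihoodRatio v₀ w y - logLikelihoodRatio v₀ v y)))
      (complexNormal v) ∧
    ∫ y, Real.exp (θ * (logLikelihoodRatio v₀ w y - logLikelihoodRatio v₀ v y))
      ∂(complexNormal v) = hellinger θ (v / w) := by
  have h : ∀ y, θ * (logLikelihoodRatio v₀ w y - logLikelihoodRatio v₀ v y) =
      θ * (Real.log v - Real.log w) - θ * (1 / w - 1 / v) * ‖y‖ ^ 2 := by
    intro y
    rw [logLikelihoodRatio_eq hv₀ hw, logLikelihoodRatio_eq hv₀ hv]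
    ring
  have hs : 1 + θ * (1 / w - 1 / v) * v = 1 + θ * (v / w - 1) := by field_simp
  have hpos : 0 < 1 + θ * (1 / w - 1 / v) * v :=
    hs ▸ one_add_mul_sub_one_pos hθ (div_pos hv hw)
  simp_rw [h]
  refine ⟨integrable_exp_sub_mul_sq_norm _ hv hpos, ?_⟩
  rw [integral_exp_sub_mul_sq_norm _ hv hpos, hs, hellinger, ← Real.log_div hv.ne' hw.ne',
    Real.rpow_def_of_pos (div_pos hv hw), mul_comm θ (Real.log _)]

/-- Serves the deterministic walk of slope `η` when `v` is near `v₀`. Bernoulli bounds `(v₀ / w) ^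
θ` by `1 + θ (u - 1)`; multiplied by `q = v / v₀ ≤ 1` this stays below the denominator `1 + θ (u -
1) q`. -/
theorem integrable_exp_mul_logLikelihoodRatio_sub_const {η : ℝ} (hwv : w ≤ v₀) (hvv : v ≤ v₀)
    (hη : Real.exp (-θ * η) ≤ v / v₀) :
    Integrable (fun y => Real.exp (θ * (logLikelihoodRatio v₀ w y - η))) (complexNormal v) ∧
    ∫ y, Real.exp (θ * (logLikelihoodRatio v₀ w y - η)) ∂(complexNormal v) ≤ 1 := by
  have h : ∀ y, θ * (logLikelihoodRatio v₀ w y - η) =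
      (θ * (Real.log v₀ - Real.log w) + -θ * η) - θ * (1 / w - 1 / v₀) * ‖y‖ ^ 2 := by
    intro y
    rw [logLikelihoodRatio_eq hv₀ hw]
    ring
  set u := v₀ / w with hu
  set q := v / v₀ with hq
  have hu1 : 1 ≤ u := (one_le_div hw).2 hwv
  have hq1 : q ≤ 1 := (div_le_one hv₀).2 hvv
  have hq0 : 0 < q := div_pos hv hv₀
  have hs : 1 + θ * (1 / w - 1 / v₀) * v = 1 + θ * (u - 1) * q := by
    rw [hu, hq]
    field_simp
  have hnn : 0 ≤ θ * (u - 1) := mul_nonneg hθ.1.le (by linarith)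
  have hpos : 0 < 1 + θ * (1 / w - 1 / v₀) * v := by
    rw [hs]
    positivity
  simp_rw [h]
  refine ⟨integrable_exp_sub_mul_sq_norm _ hv hpos, ?_⟩
  rw [integral_exp_sub_mul_sq_norm _ hv hpos, div_le_one hpos, hs, Real.exp_add,
    ← Real.log_div hv₀.ne' hw.ne', ← hu]
  have hB := rpow_one_add_le_one_add_mul_self (s := u - 1) (by linarith) hθ.1.le hθ.2.le
  rw [add_sub_cancel, Real.rpow_def_of_pos (by linarith), mul_comm (Real.log u)] at hB
  calc _ ≤ (1 + θ * (u - 1)) * q :=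
        mul_le_mul hB hη (Real.exp_pos _).le (by linarith)
    _ ≤ _ := by linarith [add_mul 1 (θ * (u - 1)) q]

end LogLikelihood

/-! ### Discretising the variance through the precision. -/

/-- On a cell of length `h` the logarithm is close to its linear interpolation. -/
theorem log_le_interpolation_add {x₀ a h l : ℝ} (hx₀ : 0 < x₀) (ha : x₀ ≤ a) (hh : 0 < h)
    (hl : l ∈ Set.Icc (0 : ℝ) 1) :
    Real.log (a + l * h) ≤ (1 - l) * Real.log a + l * Real.log (a + h) + (h / x₀) ^ 2 := by
  obtain ⟨hl0, hl1⟩ := hl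
  have ha0 : 0 < a := hx₀.trans_le ha
  have hx : 0 < a + l * h := by positivity
  have hb : 0 < a + h := by positivity
  have h1 := Real.log_le_sub_one_of_pos (div_pos hx ha0)
  have h2 := Real.log_le_sub_one_of_pos (div_pos hx hb)
  rw [Real.log_div hx.ne' ha0.ne'] at h1
  rw [Real.log_div hx.ne' hb.ne'] at h2
  have h3 := mul_le_mul_of_nonneg_left h1 (sub_nonneg.2 hl1)
  have h4 := mul_le_mul_of_nonneg_left h2 hl0
  have h5 : (1 - l) * ((a + l * h) / a - 1) + l * ((a + l * h) / (a + h) - 1) =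
      l * (1 - l) * (h ^ 2 / (a * (a + h))) := by
    field_simp
    ring
  have h6 : h ^ 2 / (a * (a + h)) ≤ (h / x₀) ^ 2 := by
    rw [div_pow]
    refine div_le_div_of_nonneg_left (by positivity) (by positivity) ?_
    rw [sq]
    exact mul_le_mul ha (by linarith) hx₀.le ha0.le
  have h7 : l * (1 - l) * (h ^ 2 / (a * (a + h))) ≤ h ^ 2 / (a * (a + h)) :=
    mul_le_of_le_one_left (by positivity) (by nlinarith)
  nlinarith

/-- The suprema over an interval of `n * log x - x * q` are approximated by those over a grid. -/
theorem exists_grid_le {x₀ x h q : ℝ} {n M : ℕ} (hx₀ : 0 < x₀) (hh : 0 < h) (hx : x₀ ≤ x)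
    (hxM : x ≤ x₀ + M * h) :
    ∃ j < M + 2, n * Real.log x - x * q ≤
      n * Real.log (x₀ + j * h) - (x₀ + j * h) * q + n * (h / x₀) ^ 2 := by
  set u := (x - x₀) / h with hu
  have hu0 : 0 ≤ u := div_nonneg (by linarith) hh.le
  have huM : u ≤ M := (div_le_iff₀ hh).2 (by linarith)
  set j := ⌊u⌋₊ with hj
  have hju : (j : ℝ) ≤ u := Nat.floor_le hu0
  have hjM : j ≤ M := by exact_mod_cast hju.trans huM
  have huj : u < j + 1 := Nat.lt_floor_add_one u
  have hxe : x = (x₀ + j * h) + (u - j) * h := by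
    rw [hu]
    field_simp
    ring
  have ha : x₀ ≤ x₀ + j * h := le_add_of_nonneg_right (by positivity)
  have hlog := log_le_interpolation_add hx₀ ha hh (l := u - j) ⟨by linarith, by linarith⟩
  rw [← hxe] at hlog
  set G : ℕ → ℝ := fun i => n * Real.log (x₀ + i * h) - (x₀ + i * h) * q with hG
  have hG1 : G (j + 1) = n * Real.log (x₀ + j * h + h) - (x₀ + j * h + h) * q := by
    simp only [hG]
    push_cast
    ring_nf
  have hn : (0 : ℝ) ≤ n := n.cast_nonneg
  have hconv : n * Real.log x - x * q ≤
      (1 - (u - j)) * G j + (u - j) * G (j + 1) + n * (h / x₀) ^ 2 := by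
    have h1 := mul_le_mul_of_nonneg_left hlog hn
    have h2 : x * q = (x₀ + j * h) * q + (u - j) * h * q := by
      nth_rw 1 [hxe]
      ring
    rw [hG1, h2]
    simp only [hG]
    linarith
  -- A convex combination is at most its larger endpoint. The right endpoint may be `M + 1`, one
  -- cell beyond the interval, hence `M + 2` points.
  rcases le_total (G j) (G (j + 1)) with hle | hle
  · refine ⟨j + 1, by omega, hconv.trans ?_⟩
    have := mul_le_mul_of_nonneg_left hle (by linarith : (0 : ℝ) ≤ 1 - (u - j))
    change _ ≤ G (j + 1) + _
    linarith
  · refine ⟨j, by omega, hconv.trans ?_⟩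
    have := mul_le_mul_of_nonneg_left hle (by linarith : (0 : ℝ) ≤ u - j)
    change _ ≤ G j + _
    linarith

/-- The `j`-th variance of the grid of mesh `(1 / vmin - 1 / v₀) / M` in the precision `1 / v`. -/
noncomputable def gridVariance (vmin v₀ : ℝ) (M j : ℕ) : ℝ :=
  (1 / v₀ + j * ((1 / vmin - 1 / v₀) / M))⁻¹

/-- The loss incurred when the variance is restricted to the grid. -/
noncomputable def gridLoss (vmin v₀ : ℝ) : ℝ := ((1 / vmin - 1 / v₀) * v₀) ^ 2

theorem sum_logLikelihoodRatio_eq {v₀ w : ℝ} (hv₀ : 0 < v₀) (hw : 0 < w) (s : Finset ℕ)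
    (y : ℕ → ℂ) :
    ∑ i ∈ s, logLikelihoodRatio v₀ w (y i) = s.card * Real.log v₀ + (∑ i ∈ s, ‖y i‖ ^ 2) / v₀ +
      (s.card * Real.log w⁻¹ - w⁻¹ * ∑ i ∈ s, ‖y i‖ ^ 2) := by
  simp_rw [logLikelihoodRatio_eq hv₀ hw]
  rw [Finset.sum_sub_distrib, ← Finset.mul_sum, Finset.sum_const, nsmul_eq_mul, Real.log_inv]
  ring

section Grid

variable {vmin v₀ : ℝ} (hvmin : vmin ∈ Set.Ioo 0 v₀) {M : ℕ} (hM : 0 < M)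
include hvmin hM

theorem gridVariance_mem (j : ℕ) : gridVariance vmin v₀ M j ∈ Set.Ioc 0 v₀ := by
  have hv₀ : 0 < v₀ := hvmin.1.trans hvmin.2
  have hd : 0 < 1 / vmin - 1 / v₀ := sub_pos.2 (one_div_lt_one_div_of_lt hvmin.1 hvmin.2)
  have h : 1 / v₀ ≤ 1 / v₀ + j * ((1 / vmin - 1 / v₀) / M) :=
    le_add_of_nonneg_right (by positivity)
  refine ⟨inv_pos.2 ((one_div_pos.2 hv₀).trans_le h), ?_⟩
  rw [gridVariance]
  exact inv_le_of_inv_le₀ hv₀ (by rwa [← one_div])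

/-- In the precision `x = 1 / w` the sum is `n ln x - x q` up to terms free of `x`. The
interpolation error is of order `n h²`; with `h` proportional to `1 / M` and `n ≤ M ^ 2` it stays
bounded independently of `M`. -/
theorem exists_sum_logLikelihoodRatio_le {w : ℝ} (hw : w ∈ Set.Icc vmin v₀) {s : Finset ℕ}
    (hs : s.card ≤ M ^ 2) (y : ℕ → ℂ) :
    ∃ j < M + 2, ∑ i ∈ s, logLikelihoodRatio v₀ w (y i) ≤
      ∑ i ∈ s, logLikelihoodRatio v₀ (gridVariance vmin v₀ M j) (y i) + gridLoss vmin v₀ := by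
  have hv₀ : 0 < v₀ := hvmin.1.trans hvmin.2
  have hw0 : 0 < w := hvmin.1.trans_le hw.1
  have hM' : (0 : ℝ) < M := by exact_mod_cast hM
  have hd : 0 < 1 / vmin - 1 / v₀ := sub_pos.2 (one_div_lt_one_div_of_lt hvmin.1 hvmin.2)
  obtain ⟨j, hj, h⟩ := exists_grid_le (x := w⁻¹) (q := ∑ i ∈ s, ‖y i‖ ^ 2) (n := s.card) (M := M)
    (one_div_pos.2 hv₀) (div_pos hd hM') (by rw [← one_div]; exact one_div_le_one_div_of_le hw0 hw.2)
    (by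
      rw [mul_div_cancel₀ _ hM'.ne', ← one_div, add_sub_cancel]
      exact one_div_le_one_div_of_le hvmin.1 hw.1)
  refine ⟨j, hj, ?_⟩
  rw [sum_logLikelihoodRatio_eq hv₀ hw0,
    sum_logLikelihoodRatio_eq hv₀ (gridVariance_mem hvmin hM j).1, gridVariance, inv_inv]
  have hloss : s.card * ((1 / vmin - 1 / v₀) / M / (1 / v₀)) ^ 2 ≤ gridLoss vmin v₀ := by
    have h1 : ((1 / vmin - 1 / v₀) / M / (1 / v₀)) ^ 2 = gridLoss vmin v₀ / (M : ℝ) ^ 2 := by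
      rw [gridLoss, ← div_pow]
      congr 1
      field_simp
    rw [h1, mul_div_assoc', div_le_iff₀ (by positivity), mul_comm]
    exact mul_le_mul_of_nonneg_left (by exact_mod_cast hs) (sq_nonneg _)
  linarith

/-- If the alarm is raised by time `n`, then some change point and some variance of the grid
explain it up to the grid loss. -/
theorem exists_grid_of_glrStoppingTime_le {ε e : ℝ} (he : e ≤ ε) {n : ℕ} (hn : n < M ^ 2)
    {y : ℕ → ℂ} (h : glrStoppingTime vmin v₀ ε y ≤ n) :
    ∃ t ≤ n, ∃ k ∈ Set.Icc 1 t, ∃ j < M + 2, e - (1 + gridLoss vmin v₀) ≤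
      ∑ i ∈ Finset.Ioc k t, logLikelihoodRatio v₀ (gridVariance vmin v₀ M j) (y i) := by
  have hne : {n : ℕ∞ | ∃ t : ℕ, n = t ∧ 1 ≤ t ∧ ε ≤ glrStatistic vmin v₀ y t}.Nonempty := by
    by_contra! h0
    rw [glrStoppingTime, h0, sInf_empty] at h
    exact absurd h (by simp)
  obtain ⟨t, ht, ht1, hεt⟩ := csInf_mem hne
  rw [glrStoppingTime, ht] at h
  have htn : t ≤ n := by exact_mod_cast h
  have : Nonempty (Set.Icc 1 t) := ⟨⟨1, le_rfl, ht1⟩⟩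
  have : Nonempty (Set.Icc vmin v₀) := ⟨⟨v₀, hvmin.2.le, le_rfl⟩⟩
  -- A slack of `1` yields a near-maximiser without attainment or boundedness of the suprema.
  have hlt : e - 1 < glrStatistic vmin v₀ y t := by linarith
  obtain ⟨⟨k, hk⟩, hlt⟩ := exists_lt_of_lt_ciSup hlt
  obtain ⟨⟨w, hw⟩, hlt⟩ := exists_lt_of_lt_ciSup hlt
  obtain ⟨j, hj, hle⟩ := exists_sum_logLikelihoodRatio_le hvmin hM hw (s := Finset.Ioc k t)
    (by rw [Nat.card_Ioc]; omega) y
  refine ⟨t, htn, k, hk, j, hj, ?_⟩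
  simp only at hlt
  linarith

/-- The walk `X` is left free because two are used: the true log-likelihood ratio, and a constant
when `v` is near `v₀`. -/
theorem exists_le_lintegral_glrStoppingTime {μ : Measure ℂ} [IsProbabilityMeasure μ] {X : ℂ → ℝ}
    (hX : Measurable X) (hXi : Integrable X μ) {J : ℝ} (hXJ : ∫ x, X x ∂μ ≤ J) {θ ρ : ℝ}
    (hθ : 0 < θ) (hρ0 : 0 < ρ) (hρ1 : ρ < 1)
    (h1 : Integrable (fun x => Real.exp (-θ * X x)) μ ∧ ∫ x, Real.exp (-θ * X x) ∂μ ≤ ρ)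
    (h2 : ∀ w ∈ Set.Ioc 0 v₀, Integrable
        (fun x => Real.exp (θ * (logLikelihoodRatio v₀ w x - X x))) μ ∧
      ∫ x, Real.exp (θ * (logLikelihoodRatio v₀ w x - X x)) ∂μ ≤ 1)
    {ε e : ℝ} (he0 : 0 ≤ e) (he : e ≤ ε) (heM : Real.exp (θ * e) * ρ ^ (M ^ 2) ≤ 1) :
    ∃ R : ℝ, ENNReal.ofReal R ≤ ∫⁻ y, (glrStoppingTime vmin v₀ ε y : ℝ≥0∞)
        ∂(Measure.infinitePi fun _ : ℕ => μ) ∧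
      e - (1 + gridLoss vmin v₀) - 1 / θ * (Real.log ((M + 2 : ℕ) / (1 - ρ)) + 1) ≤ J * R :=
  exists_le_lintegral_detectionTime hX hXi hXJ
    (ℓ := fun j => logLikelihoodRatio v₀ (gridVariance vmin v₀ M j))
    (fun _ => measurable_logLikelihoodRatio _ _) hθ hρ0 hρ1 h1.1 h1.2
    (fun j => (h2 _ (gridVariance_mem hvmin hM j)).1)
    (fun j => (h2 _ (gridVariance_mem hvmin hM j)).2) (by positivity) (by positivity) he0
    (add_nonneg zero_le_one (sq_nonneg _)) heM
    fun _ _ hn h => exists_grid_of_glrStoppingTime_le hvmin hM he hn h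

end Grid

/-! ### Choice of the constants and conclusion. -/

/-- The excess `log A` of the threshold over `A` outweighs the loss caused by a grid of
`O(√A)` points. -/
theorem exists_grid_size {ρ : ℝ} (hρ0 : 0 < ρ) (hρ1 : ρ < 1) (K : ℝ) :
    ∃ A₀ : ℝ, 1 ≤ A₀ ∧ ∀ A, A₀ ≤ A → ∃ M : ℕ, 0 < M ∧
      Real.exp (3 / 4 * (A + Real.log A)) * ρ ^ (M ^ 2) ≤ 1 ∧
      A ≤ A + Real.log A - K - 1 / (3 / 4) * (Real.log ((M + 2 : ℕ) / (1 - ρ)) + 1) := by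
  set r := -Real.log ρ with hr
  have hr0 : 0 < r := neg_pos.2 (Real.log_neg hρ0 hρ1)
  -- Chosen so that `r * M ^ 2 ≥ 2 * A`, which exceeds `3 / 4 * (A + log A)`.
  set D := √(2 / r) with hD
  have hD0 : 0 < D := Real.sqrt_pos.2 (by positivity)
  have h1ρ : 0 < 1 - ρ := by linarith
  set G := (D + 3) / (1 - ρ) with hG
  have hG0 : 0 < G := by positivity
  -- The grid costs `4 / 3 * (1 / 2) * log A`; the remaining third of `log A` must cover the
  -- constants, hence the factor `3`.
  set B := 3 * (K + 4 / 3 * (Real.log G + 1)) with hB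
  refine ⟨max 1 (Real.exp B), le_max_left _ _, fun A hA => ?_⟩
  have hA1 : 1 ≤ A := (le_max_left _ _).trans hA
  have hA0 : 0 < A := by linarith
  have hBA : B ≤ Real.log A := (Real.le_log_iff_exp_le hA0).2 ((le_max_right _ _).trans hA)
  have hs1 : 1 ≤ √A := Real.one_le_sqrt.2 hA1
  set M := ⌈D * √A⌉₊ with hM
  have hM1 : D * √A ≤ M := Nat.le_ceil _
  have hM2 : (M : ℝ) < D * √A + 1 := Nat.ceil_lt_add_one (by positivity)
  refine ⟨M, Nat.ceil_pos.2 (by positivity), ?_, ?_⟩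
  · have hMA : 2 * A ≤ r * (M : ℝ) ^ 2 := by
      have h1 : (D * √A) ^ 2 ≤ (M : ℝ) ^ 2 := pow_le_pow_left₀ (by positivity) hM1 2
      rw [mul_pow, Real.sq_sqrt hA0.le, hD, Real.sq_sqrt (by positivity)] at h1
      calc 2 * A = r * (2 / r * A) := by field_simp
        _ ≤ _ := mul_le_mul_of_nonneg_left h1 hr0.le
    have hlogA := Real.log_le_sub_one_of_pos hA0
    have hρe : ρ ^ (M ^ 2) = Real.exp (-(r * (M : ℝ) ^ 2)) := by
      rw [← Real.rpow_natCast, Real.rpow_def_of_pos hρ0, hr]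
      push_cast
      ring_nf
    rw [hρe, ← Real.exp_add, Real.exp_le_one_iff]
    linarith
  · have h1 : ((M + 2 : ℕ) : ℝ) / (1 - ρ) ≤ G * √A := by
      rw [hG, div_mul_eq_mul_div]
      refine div_le_div_of_nonneg_right ?_ h1ρ.le
      push_cast
      linarith
    have h2 := Real.log_le_log (by positivity) h1
    rw [Real.log_mul hG0.ne' (by positivity), Real.log_sqrt hA0.le] at h2
    linarith

/-- Of `b` only `b ≥ ln(a⁻¹)` matters here: it supplies the surplus that pays for the grid. -/
theorem add_log_le_glrThreshold {vmin v₀ a : ℝ} (hvmin : vmin ∈ Set.Ioo 0 v₀) (ha : 0 < a)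
    (hA : 0 < Real.log a⁻¹) :
    Real.log a⁻¹ + Real.log (Real.log a⁻¹) ≤ glrThreshold vmin v₀ a := by
  have hI := klInfo_pos hvmin
  have hb : Real.log a⁻¹ ≤ glrB vmin v₀ a := by
    have h1 : (1 : ℝ) ≤ (1 + 1 / klInfo v₀ vmin) ^ 2 :=
      one_le_pow₀ (le_add_of_nonneg_right (by positivity))
    rw [glrB]
    nlinarith
  rw [glrThreshold, Real.log_div ha.ne' (hA.trans_le hb).ne']
  have := Real.log_le_log hA hb
  rw [Real.log_inv] at *
  linarith

theorem ofReal_le_of_le_mul {J R A τ : ℝ} {I : ℝ≥0∞} (hJ : 0 < J) (hτ : τ ≤ A / J)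
    (hR : ENNReal.ofReal R ≤ I) (h : A ≤ J * R) : ENNReal.ofReal τ ≤ I :=
  (ENNReal.ofReal_le_ofReal (hτ.trans ((div_le_iff₀' hJ).2 h))).trans hR

theorem exists_forall_le_arld {vmin v₀ C : ℝ} (hvmin : vmin ∈ Set.Ioo 0 v₀) (hC : 0 < C) :
    ∃ a₀ ∈ Set.Ioo (0 : ℝ) 1, ∀ a ∈ Set.Ioo 0 a₀, ∀ τ : ℝ, 0 < τ → τ ≤ C * Real.log a⁻¹ →
      ∀ v ∈ Set.Icc vmin v₀, v - v₀ * Real.log v ≤ attackBound v₀ a τ →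
        ENNReal.ofReal τ ≤ arld vmin v₀ a v := by
  have hv₀ : 0 < v₀ := hvmin.1.trans hvmin.2
  have hθ : (3 / 4 : ℝ) ∈ Set.Ioo (0 : ℝ) 1 := by constructor <;> norm_num
  -- For the constant walk `C⁻¹`, `q` is both its exponential moment and the ratio `v / v₀` from
  -- which that walk is admissible.
  set q := Real.exp (-(3 / 4) * C⁻¹) with hq
  have hC' : 0 < C⁻¹ := inv_pos.2 hC
  have hq1 : q < 1 := (Real.exp_lt_exp.2 (by linarith)).trans_eq Real.exp_zero
  have hq0 : 0 < q := Real.exp_pos _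
  -- Ratios `v / v₀` below `q` lie in a compact set avoiding `1`, so one `ρ`, and hence one `a₀`,
  -- serves every `v`.
  obtain ⟨ρ₁, hρ₁, hρ₁'⟩ := exists_hellinger_le hθ (div_pos hvmin.1 hv₀) hq1
  set ρ := max q ρ₁ with hρ
  have hρ0 : 0 < ρ := hq0.trans_le (le_max_left _ _)
  have hρ1 : ρ < 1 := max_lt hq1 hρ₁
  obtain ⟨A₀, hA₀, hM⟩ := exists_grid_size hρ0 hρ1 (1 + gridLoss vmin v₀)
  refine ⟨Real.exp (-A₀), ⟨Real.exp_pos _,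
    (Real.exp_lt_exp.2 (by linarith)).trans_eq Real.exp_zero⟩, ?_⟩
  rintro a ⟨ha0, ha⟩ τ hτ hτC v ⟨hvv, hv1⟩ hcond
  set A := Real.log a⁻¹ with hA
  have hv : 0 < v := hvmin.1.trans_le hvv
  have hAA : A₀ ≤ A := by
    have := (Real.log_lt_iff_lt_exp ha0).2 ha
    rw [hA, Real.log_inv]
    linarith
  have hA1 : 1 ≤ A := hA₀.trans hAA
  obtain ⟨M, hM0, hM1, hM2⟩ := hM A hAA
  have he0 : 0 ≤ A + Real.log A := add_nonneg (by linarith) (Real.log_nonneg hA1)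
  have heε := add_log_le_glrThreshold hvmin ha0 (by linarith)
  rcases le_or_gt q (v / v₀) with hcase | hcase
  · obtain ⟨R, hR, hRJ⟩ := exists_le_lintegral_glrStoppingTime hvmin hM0 (μ := complexNormal v)
      (X := fun _ => C⁻¹) measurable_const (integrable_const _) (J := C⁻¹) (by simp) hθ.1 hρ0 hρ1
      ⟨integrable_const _, by
        rw [integral_const, probReal_univ, one_smul]
        exact le_max_left q ρ₁⟩
      (fun w hw => integrable_exp_mul_logLikelihoodRatio_sub_const hv₀ hv hw.1 hθ hw.2 hv1 hcase)
      he0 heε hM1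
    refine ofReal_le_of_le_mul hC' ?_ hR (hM2.trans hRJ)
    rwa [div_inv_eq_mul, mul_comm]
  · have hvlt : v < v₀ := (div_lt_one hv₀).1 (hcase.trans hq1)
    -- The ratio of `v₀` to itself has logarithm `0`, so the moment of `-X` is the Hellinger
    -- integral with `w = v₀`.
    have h0 : ∀ y, -(3 / 4 : ℝ) * logLikelihoodRatio v₀ v y =
        3 / 4 * (logLikelihoodRatio v₀ v₀ y - logLikelihoodRatio v₀ v y) := by
      intro y
      rw [logLikelihoodRatio_eq hv₀ hv₀]
      ring
    have hI := klInfo_pos ⟨hv, hvlt⟩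
    obtain ⟨R, hR, hRJ⟩ := exists_le_lintegral_glrStoppingTime hvmin hM0 (μ := complexNormal v)
      (X := logLikelihoodRatio v₀ v) (measurable_logLikelihoodRatio _ _)
      (integrable_logLikelihoodRatio hv₀ hv hv) (J := klInfo v₀ v) le_rfl hθ.1 hρ0 hρ1
      (by
        simp_rw [h0]
        have h := integrable_exp_mul_logLikelihoodRatio_sub hv₀ hv hv₀ hθ
        refine ⟨h.1, h.2.trans_le ?_⟩
        exact (hρ₁' _ ⟨div_le_div_of_nonneg_right hvv hv₀.le, hcase.le⟩).trans (le_max_right _ _))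
      (fun w hw => by
        have h := integrable_exp_mul_logLikelihoodRatio_sub hv₀ hv hw.1 hθ
        exact ⟨h.1, h.2.trans_le (hellinger_le_one hθ (div_pos hv hw.1))⟩)
      he0 heε hM1
    refine ofReal_le_of_le_mul hI ?_ hR (hM2.trans hRJ)
    exact (le_div_comm₀ hτ hI).2 ((sub_mul_log_le_attackBound_iff hv₀ hv).1 hcond)

end GLRAttack

theorem mainTheorem7 (v₀ : ℝ) (hv₀ : 0 < v₀) :
    -- the condition says that the lower bound `ln(a⁻¹) / I(v)` is at least `τ`,
    -- and it reduces to a threshold on `v`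
    (∀ a ∈ Set.Ioo (0 : ℝ) 1, ∀ τ : ℝ, 0 < τ →
      (∀ v ∈ Set.Ioo 0 v₀, 0 < GLRAttack.klInfo v₀ v ∧
        (τ ≤ Real.log a⁻¹ / GLRAttack.klInfo v₀ v ↔
          v - v₀ * Real.log v ≤ GLRAttack.attackBound v₀ a τ)) ∧
      ∃ Q ∈ Set.Ioo 0 v₀, ∀ v ∈ Set.Ioc 0 v₀,
        (v - v₀ * Real.log v ≤ GLRAttack.attackBound v₀ a τ ↔ Q ≤ v)) ∧
    -- the condition ensures that the average run length to detection is at least `τ`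
    (∀ vmin ∈ Set.Ioo 0 v₀, ∀ C : ℝ, 0 < C →
      ∃ a₀ ∈ Set.Ioo (0 : ℝ) 1, ∀ a ∈ Set.Ioo 0 a₀, ∀ τ : ℝ, 0 < τ → τ ≤ C * Real.log a⁻¹ →
        ∀ v ∈ Set.Icc vmin v₀, v - v₀ * Real.log v ≤ GLRAttack.attackBound v₀ a τ →
          ENNReal.ofReal τ ≤ GLRAttack.arld vmin v₀ a v) := by
  refine ⟨fun a ha τ hτ => ⟨fun v hv => ⟨GLRAttack.klInfo_pos hv, ?_⟩,
    GLRAttack.exists_threshold hv₀ ha hτ⟩, fun vmin hvmin C hC =>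
    GLRAttack.exists_forall_le_arld hvmin hC⟩
  rw [GLRAttack.sub_mul_log_le_attackBound_iff hv₀ hv.1]
  exact le_div_comm₀ hτ (GLRAttack.klInfo_pos hv)
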